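/- For a topological space $Y$ and $q\in\mathbb Z$ let $H_q(Y)$ denote the reduced singular homology group with integer coefficients, i.e. the homology of the augmented singular chain complex $\cdots\to C_2\to C_1\to C_0\to\mathbb Z\to 0$, in which $C_0\to\mathbb Z$ takes each $0$-simplex to $1$ and $\mathbb Z$ has degree $-1$ (so $H_q(Y)=0$ for $q<-1$, and $H_{-1}(Y)=0$ if and only if $Y\neq\emptyset$). Call $Y$ acyclic if $H_q(Y)=0$ for all $q$; in particular an acyclic space is nonempty. Call a family $\{V_\alpha\}_{\alpha\in T}$ of subsets of a topological space, with union $V=\bigcup_{\alpha\in T}V_\alpha$, excisive if $V=\bigcup_{\alpha\in T}\operatorname{int}_{V}(V_\alpha)$, where $\operatorname{int}_V$ denotes the interior relative to $V$. Let $X$ be a topological space, $\{U_\alpha\}_{\alpha\in S}$ a finite family of subsets of $X$, and $k\ge 1$ an integer. Assume that the family satisfies condition $A_{k-1}$: for every nonempty $\sigma\subset S$ with at most $k$ elements, the intersection $U_\sigma=\bigcap_{\alpha\in\sigma}U_\alpha$ is acyclic. Let $\theta\subset S$ have exactly $k+1$ elements, and assume that the subfamily $\{U_\alpha\}_{\alpha\in\theta}$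 is excisive. Then for every $q\in\mathbb Z$ $$H_q\Big(\bigcup_{\alpha\in\theta}U_\alpha\Big)\;\cong\;H_{q-k}\Big(\bigcap_{\alpha\in\theta}U_\alpha\Big).$$ -/

import Mathlib

open CategoryTheory Limits AlgebraicTopology

universe u

noncomputable section

namespace ReducedSingular

/-- The coefficient group `ℤ`, as an abelian group in the universe of the spaces. -/
abbrev coeff : AddCommGrpCat.{u} := AddCommGrpCat.of (ULift.{u} ℤ)

/-- The unreduced singular chain complex `⋯ → C₂ → C₁ → C₀` with integer coefficients. -/
abbrev chains (Y : Type u) [TopologicalSpace Y] : ChainComplex AddCommGrpCat.{u} ℕ :=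
  ((singularChainComplexFunctor AddCommGrpCat.{u}).obj coeff).obj (TopCat.of Y)

/-- The augmentation `C₀ → ℤ` which takes each singular `0`-simplex to `1`. -/
def augmentation (Y : Type u) [TopologicalSpace Y] : (chains Y).X 0 ⟶ coeff :=
  Sigma.desc fun _ => 𝟙 _

theorem d_comp_augmentation (Y : Type u) [TopologicalSpace Y] :
    (chains Y).d 1 0 ≫ augmentation Y = 0 := by
  let K := TopCat.toSSet.obj (TopCat.of Y)
  let e : (K.chainComplex (coeff.{u})).X 0 ⟶ coeff.{u} := augmentation Y
  have h : ∀ y, K.ιChainComplex (R := coeff.{u}) (n := 0) y ≫ e = 𝟙 _ :=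
    fun y => Sigma.ι_desc _ _
  have key : (K.chainComplex (coeff.{u})).d 1 0 ≫ e = 0 := by
    refine SSet.chainComplex_hom_ext fun x => ?_
    rw [SSet.ιChainComplex_d_assoc, Fin.sum_univ_two, Preadditive.add_comp, Preadditive.zsmul_comp,
      Preadditive.zsmul_comp, h, h]
    simp
  exact key

/-- The augmented complex `⋯ → C₂ → C₁ → C₀ → ℤ → 0`; here `ℤ` sits in index `0` and `C_q` in
index `q + 1`. -/
def augmentedChains (Y : Type u) [TopologicalSpace Y] : ChainComplex AddCommGrpCat.{u} ℕ :=
  ChainComplex.augment (chains Y) (augmentation Y) (d_comp_augmentation Y)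

/-- The reduced singular homology group `H_q(Y)` with integer coefficients, for every integer `q`:
the homology of `⋯ → C₁ → C₀ → ℤ → 0` at `C_q` for `q ≥ 0`, at `ℤ` for `q = -1`, and zero for
`q < -1`. -/
def H (Y : Type u) [TopologicalSpace Y] : ℤ → AddCommGrpCat.{u}
  | Int.ofNat n => (augmentedChains Y).homology (n + 1)
  | Int.negSucc 0 => (augmentedChains Y).homology 0
  | Int.negSucc (_ + 1) => AddCommGrpCat.of PUnit.{u + 1}

/-- A space is acyclic if all its reduced homology groups vanish, including the one in degree
`-1`, so that the empty space is not acyclic. -/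
def IsAcyclic (Y : Type u) [TopologicalSpace Y] : Prop :=
  ∀ q : ℤ, IsZero (H Y q)

variable {X : Type u} [TopologicalSpace X]

/-- The interior of `A` relative to the subspace `W`, as a subset of the ambient space. -/
def relInterior (W A : Set X) : Set X :=
  Subtype.val '' interior (Subtype.val ⁻¹' A : Set W)

/-- A family of sets is excisive if its union is the union of the interiors of its members
relative to that union. -/
def IsExcisive {ι : Type*} (V : ι → Set X) : Prop :=
  ⋃ i, V i = ⋃ i, relInterior (⋃ j, V j) (V i)

/-- The intersection `U_θ` of the subfamily indexed by `θ`. -/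
def interOf {S : Type*} (U : S → Set X) (θ : Finset S) : Set X := ⋂ α ∈ θ, U α

/-- The union `U^θ` of the subfamily indexed by `θ`. -/
def unionOf {S : Type*} (U : S → Set X) (θ : Finset S) : Set X := ⋃ α ∈ θ, U α

/-- Condition `A_k`: the intersection of every (nonempty) subfamily with at most `k + 1` members
is acyclic. -/
def ConditionA {S : Type*} (U : S → Set X) (k : ℕ) : Prop :=
  ∀ θ : Finset S, θ.Nonempty → θ.card ≤ k + 1 → IsAcyclic (interOf U θ)

end ReducedSingular

end

/-!
A family of subspaces all of whose intersections of at most `k` members are acyclic behaves, for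
chains, like a family of subcomplexes, for which Mayer–Vietoris holds without any hypothesis on
open sets. For families `R i` of simplices closed under precomposition with affine maps, this
is `nonempty_HIn_iSup_iso`, by induction on `k`. Split off one member `R a` from `k + 2` members.
The union `K` of the other members is acyclic by the induction hypothesis, because their common
intersection is, and so the connecting homomorphism `H_q(K ∪ R a) → H_{q-1}(K ∩ R a)` is an
isomorphism. As `K ∩ R a` is the union of the `k + 1` families `R i ∩ R a`, the induction hypothesis
computes its homology.

For subspaces `U i` the simplices lying in some `U i` are fewer than those of the union, but for an
excisive family they have the same homology (`nonempty_HIn_iSup_simpIn_iso`). This is proved with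
barycentric subdivision. To keep the algebra of subdivision simple, simplices are indexed by their
number `n` of vertices, so that the unique simplex with no vertices gives the augmentation, and a
chain of affine simplices in the standard simplex acts on the chains of every space by
precomposition (`precomp`). The boundary, subdivision, and the homotopy between subdivision and the
identity are the actions of universal chains `faces`, `subdivision` and `homotopyChain`; the last
two are defined recursively as cones from the barycenter, and the identities between them follow
from the boundary formula of a cone (`bd_cone`) and associativity. Subdivision contracts the mesh by
a factor less than one, and the Lebesgue number lemma finishes the argument.

Finally `nonempty_H_iso` identifies these homology groups with those of the augmented singular chain
complex of a subspace.
-/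

noncomputable section

namespace ReducedSingular

/-! ### Chains on families of simplices with affine reparametrisations -/

/-- The `n`-tuples of points of the standard simplex with `m` vertices. They stand for the affine
maps into it from the standard simplex with `n` vertices. -/
def Tuple (m n : ℕ) : Type := Fin n → stdSimplex ℝ (Fin m)

/-- The point with barycentric coordinates `p` relative to the points `w j` of a simplex. -/
def combine {n m : ℕ} (p : stdSimplex ℝ (Fin n)) (w : Tuple m n) :
    stdSimplex ℝ (Fin m) :=
  ⟨∑ j, p j • (w j : Fin m → ℝ),
    (convex_stdSimplex ℝ (Fin m)).sum_mem (fun j _ => p.2.1 j) p.2.2 fun j _ => (w j).2⟩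

theorem coe_combine {n m : ℕ} (p : stdSimplex ℝ (Fin n)) (w : Tuple m n) :
    (combine p w).1 = ∑ j, p j • (w j).1 := rfl

theorem combine_apply {n m : ℕ} (p : stdSimplex ℝ (Fin n)) (w : Tuple m n)
    (l : Fin m) : combine p w l = ∑ j, p j * w j l := by
  change (combine p w).1 l = _
  rw [coe_combine, Finset.sum_apply]
  rfl

theorem continuous_combine {n m : ℕ} (w : Tuple m n) :
    Continuous fun p : stdSimplex ℝ (Fin n) => combine p w := by
  have h : Continuous fun p : stdSimplex ℝ (Fin n) => ∑ j, p.1 j • (w j : Fin m → ℝ) :=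
    continuous_finsetSum _ fun j _ =>
      ((continuous_apply j).comp continuous_subtype_val).smul continuous_const
  exact h.subtype_mk _

namespace Tuple

/-- The tuple of the vertices of the standard simplex. -/
def vertices (n : ℕ) : Tuple n n := fun i => stdSimplex.vertex i

/-- The composition of affine maps. -/
def comp {k m n : ℕ} (w : Tuple k m) (v : Tuple m n) : Tuple k n := fun i => combine (v i) w

theorem combine_vertices {n : ℕ} (p : stdSimplex ℝ (Fin n)) : combine p (vertices n) = p := by
  ext l
  simp [combine_apply, vertices, Pi.single_apply]

theorem vertex_combine {n m : ℕ} (i : Fin n) (w : Tuple m n) :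
    combine (stdSimplex.vertex i) w = w i := by
  ext l
  simp [combine_apply, Pi.single_apply]

theorem combine_comp {n m k : ℕ} (p : stdSimplex ℝ (Fin n)) (v : Tuple m n) (w : Tuple k m) :
    combine p (comp w v) = combine (combine p v) w := by
  ext l
  simp only [combine_apply, comp, Finset.sum_mul, Finset.mul_sum, mul_assoc]
  exact Finset.sum_comm

/-- The tuple `w` with the point `b` put in front. -/
def cons {m n : ℕ} (b : stdSimplex ℝ (Fin m)) (w : Tuple m n) : Tuple m (n + 1) :=
  Fin.cons (α := fun _ => stdSimplex ℝ (Fin m)) b w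

/-- The inclusion of the face opposite to the vertex `i`. -/
def face {n : ℕ} (i : Fin (n + 1)) : Tuple (n + 1) n := fun j => stdSimplex.vertex (i.succAbove j)

theorem cons_zero {m n : ℕ} (b : stdSimplex ℝ (Fin m)) (w : Tuple m n) : cons b w 0 = b := rfl

theorem cons_succ {m n : ℕ} (b : stdSimplex ℝ (Fin m)) (w : Tuple m n) (i : Fin n) :
    cons b w i.succ = w i := rfl

theorem exists_eq_cons {m n : ℕ} (w : Tuple m (n + 1)) :
    ∃ (b : stdSimplex ℝ (Fin m)) (w' : Tuple m n), w = cons b w' :=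
  ⟨w 0, fun i => w i.succ, (Fin.cons_self_tail (α := fun _ => stdSimplex ℝ (Fin m)) w).symm⟩

theorem comp_face {m n : ℕ} (w : Tuple m (n + 1)) (i : Fin (n + 1)) (j : Fin n) :
    comp w (face i) j = w (i.succAbove j) :=
  vertex_combine _ _

theorem cons_comp_face_zero {m n : ℕ} (b : stdSimplex ℝ (Fin m)) (w : Tuple m n) :
    comp (cons b w) (face 0) = w := by
  funext j
  rw [comp_face, Fin.succAbove_zero, cons_succ]

theorem cons_comp_face_succ {m n : ℕ} (b : stdSimplex ℝ (Fin m)) (w : Tuple m (n + 1))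
    (i : Fin (n + 1)) : comp (cons b w) (face i.succ) = cons b (comp w (face i)) := by
  funext j
  refine Fin.cases ?_ (fun j => ?_) j
  · rw [comp_face, Fin.succ_succAbove_zero, cons_zero, cons_zero]
  · rw [comp_face, Fin.succ_succAbove_succ, cons_succ, cons_succ, comp_face]

theorem comp_cons {k m n : ℕ} (w : Tuple k m) (b : stdSimplex ℝ (Fin m)) (v : Tuple m n) :
    comp w (cons b v) = cons (combine b w) (comp w v) := by
  funext j
  exact Fin.cases rfl (fun _ => rfl) j

theorem comp_assoc {k l m n : ℕ} (w : Tuple k l) (v : Tuple l m) (u : Tuple m n) :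
    comp (comp w v) u = comp w (comp v u) := by
  funext i
  exact combine_comp _ _ _

theorem comp_vertices {m n : ℕ} (w : Tuple m n) : comp w (vertices n) = w := by
  funext i
  exact vertex_combine _ _

theorem vertices_comp {m n : ℕ} (w : Tuple m n) : comp (vertices m) w = w := by
  funext i
  exact combine_vertices _

end Tuple

/-- A family of simplices, indexed by the number of vertices, which can be precomposed with affine
maps between standard simplices. -/
class AffineSimplices (P : ℕ → Type*) where
  /-- Precomposition with the affine map given by a tuple. -/
  act : ∀ {m n : ℕ}, P m → Tuple m n → P n
  act_comp : ∀ {m n k : ℕ} (x : P m) (v : Tuple m n) (w : Tuple n k),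
    act x (v.comp w) = act (act x v) w
  act_vertices : ∀ {n : ℕ} (x : P n), act x (Tuple.vertices n) = x

open AffineSimplices

instance (k : ℕ) : AffineSimplices (Tuple k) where
  act w v := w.comp v
  act_comp x v w := (Tuple.comp_assoc x v w).symm
  act_vertices x := x.comp_vertices

theorem tuple_act {k m n : ℕ} (w : Tuple k m) (v : Tuple m n) : act w v = w.comp v := rfl

/-- The chains with integer coefficients on the simplices with `n` vertices. The chains with no
vertices make up the augmentation group. -/
abbrev Chains (P : ℕ → Type*) (n : ℕ) : Type _ := P n →₀ ℤ

section Universal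

variable {P : ℕ → Type*} [AffineSimplices P]

/-- The bilinear extension of the precomposition of simplices with affine maps. -/
def precomp {m n : ℕ} : Chains P m →ₗ[ℤ] Chains (Tuple m) n →ₗ[ℤ] Chains P n :=
  Finsupp.linearCombination ℤ fun x => Finsupp.lmapDomain ℤ ℤ (act x)

theorem precomp_single {m n : ℕ} (x : P m) (v : Tuple m n) (a b : ℤ) :
    precomp (Finsupp.single x a) (Finsupp.single v b) = Finsupp.single (act x v) (a * b) := by
  simp [precomp]

theorem precomp_precomp {m n k : ℕ} (x : Chains P m) (a : Chains (Tuple m) n)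
    (b : Chains (Tuple n) k) :
    precomp (precomp x a) b = precomp x (precomp a b) := by
  induction x using Finsupp.induction_linear with
  | zero => simp
  | add x y hx hy => simp [hx, hy]
  | single x r =>
    induction a using Finsupp.induction_linear with
    | zero => simp
    | add x y hx hy => simp [hx, hy]
    | single a s =>
      induction b using Finsupp.induction_linear with
      | zero => simp
      | add x y hx hy => simp [hx, hy]
      | single b t => simp only [precomp_single, tuple_act, act_comp, mul_assoc]

/-- The identity tuple, as a chain. -/
def idChain (n : ℕ) : Chains (Tuple n) n := Finsupp.single (Tuple.vertices n) 1

theorem precomp_idChain {n : ℕ} (x : Chains P n) : precomp x (idChain n) = x := by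
  induction x using Finsupp.induction_linear with
  | zero => simp
  | add x y hx hy => simp [hx, hy]
  | single x r => rw [idChain, precomp_single, act_vertices, mul_one]

theorem idChain_precomp {m n : ℕ} (a : Chains (Tuple m) n) : precomp (idChain m) a = a := by
  induction a using Finsupp.induction_linear with
  | zero => simp
  | add x y hx hy => simp [hx, hy]
  | single v r =>
    rw [idChain, precomp_single, one_mul, tuple_act, Tuple.vertices_comp]

/-- The alternating sum of the faces of the standard simplex. -/
def faces (n : ℕ) : Chains (Tuple (n + 1)) n :=
  ∑ i : Fin (n + 1), Finsupp.single (Tuple.face i) ((-1) ^ (i : ℕ))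

/-- The boundary operator: the alternating sum of the faces. On simplices with one vertex it is the
augmentation. -/
def bd {n : ℕ} : Chains P (n + 1) →ₗ[ℤ] Chains P n := precomp.flip (faces n)

theorem bd_eq_precomp {n : ℕ} (x : Chains P (n + 1)) : bd x = precomp x (faces n) := rfl

theorem bd_single {n : ℕ} (x : P (n + 1)) (r : ℤ) :
    bd (Finsupp.single x r) =
      ∑ i : Fin (n + 1), Finsupp.single (act x (Tuple.face i)) (r * (-1) ^ (i : ℕ)) := by
  simp only [bd_eq_precomp, faces, map_sum, precomp_single]

theorem bd_precomp {m n : ℕ} (x : Chains P m) (a : Chains (Tuple m) (n + 1)) :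
    bd (precomp x a) = precomp x (bd a) :=
  precomp_precomp _ _ _

theorem bd_idChain (n : ℕ) : bd (idChain (n + 1)) = faces n :=
  idChain_precomp _

/-- The cone with apex `b` on a chain of affine simplices: `b` becomes the first vertex. -/
def cone {m n : ℕ} (b : stdSimplex ℝ (Fin m)) :
    Chains (Tuple m) n →ₗ[ℤ] Chains (Tuple m) (n + 1) :=
  Finsupp.lmapDomain ℤ ℤ (Tuple.cons b)

theorem cone_single {m n : ℕ} (b : stdSimplex ℝ (Fin m)) (w : Tuple m n) (r : ℤ) :
    cone b (Finsupp.single w r) = Finsupp.single (Tuple.cons b w) r := by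
  simp [cone]

theorem bd_cone_zero {m : ℕ} (b : stdSimplex ℝ (Fin m)) (c : Chains (Tuple m) 0) :
    bd (cone b c) = c := by
  induction c using Finsupp.induction_linear with
  | zero => simp
  | add x y hx hy => simp [hx, hy]
  | single w r =>
    rw [cone_single, bd_single]
    simp [tuple_act, Tuple.cons_comp_face_zero]

/-- For chains without vertices the last term is missing; see `bd_cone_zero`. -/
theorem bd_cone {m n : ℕ} (b : stdSimplex ℝ (Fin m)) (c : Chains (Tuple m) (n + 1)) :
    bd (cone b c) = c - cone b (bd c) := by
  induction c using Finsupp.induction_linear with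
  | zero => simp
  | add x y hx hy => simp only [map_add, hx, hy]; abel
  | single w r =>
    rw [cone_single, bd_single, bd_single, Fin.sum_univ_succ, tuple_act,
      Tuple.cons_comp_face_zero, map_sum, sub_eq_add_neg, ← Finset.sum_neg_distrib]
    congr 1
    · simp
    · refine Finset.sum_congr rfl fun i _ => ?_
      rw [tuple_act, Tuple.cons_comp_face_succ, cone_single, ← Finsupp.single_neg]
      congr 1
      rw [Fin.val_succ, pow_succ]
      ring

/-- Every tuple is the cone on its tail, so that this follows from the boundary formula for cones,
by induction. -/
theorem bd_bd_tuple {m : ℕ} : ∀ {n : ℕ} (c : Chains (Tuple m) (n + 2)), bd (bd c) = 0 := by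
  intro n
  induction n with
  | zero =>
    intro c
    induction c using Finsupp.induction_linear with
    | zero => simp
    | add x y hx hy => simp [hx, hy]
    | single w r =>
      obtain ⟨b, w, rfl⟩ := w.exists_eq_cons
      rw [← cone_single, bd_cone, map_sub, bd_cone_zero, sub_self]
  | succ n ih =>
    intro c
    induction c using Finsupp.induction_linear with
    | zero => simp
    | add x y hx hy => simp [hx, hy]
    | single w r =>
      obtain ⟨b, w, rfl⟩ := w.exists_eq_cons
      rw [← cone_single, bd_cone, map_sub, bd_cone, ih]
      simp

theorem precomp_faces_faces (n : ℕ) : precomp (faces (n + 1)) (faces n) = 0 := by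
  rw [← bd_idChain (n + 1), ← bd_eq_precomp, bd_bd_tuple]

theorem bd_bd {n : ℕ} (x : Chains P (n + 2)) : bd (bd x) = 0 := by
  rw [bd_eq_precomp, bd_eq_precomp, precomp_precomp, precomp_faces_faces, map_zero]

/-! ### Barycentric subdivision -/

/-- The barycentric subdivision of the standard simplex with `n` vertices: the cone from the
barycenter on the subdivision of the boundary. -/
def subdivision : ∀ n : ℕ, Chains (Tuple n) n
  | 0 => idChain 0
  | n + 1 => cone stdSimplex.barycenter (precomp (faces n) (subdivision n))

/-- The universal chain for the homotopy between the identity and barycentric subdivision. -/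
def homotopyChain : ∀ n : ℕ, Chains (Tuple n) (n + 1)
  | 0 => 0
  | n + 1 => cone stdSimplex.barycenter (idChain (n + 1) - precomp (faces n) (homotopyChain n))

theorem bd_subdivision (n : ℕ) : bd (subdivision (n + 1)) = precomp (faces n) (subdivision n) := by
  induction n with
  | zero => exact bd_cone_zero _ _
  | succ n ih =>
    rw [subdivision, bd_cone, bd_precomp, ih, ← precomp_precomp, precomp_faces_faces]
    simp

theorem bd_homotopyChain_zero : bd (homotopyChain 0) = idChain 0 - subdivision 0 := by
  simp [homotopyChain, subdivision]

theorem bd_homotopyChain (n : ℕ) :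
    bd (homotopyChain (n + 1)) =
      idChain (n + 1) - subdivision (n + 1) - precomp (faces n) (homotopyChain n) := by
  have key : bd (idChain (n + 1) - precomp (faces n) (homotopyChain n)) =
      precomp (faces n) (subdivision n) := by
    rw [map_sub, bd_idChain, bd_precomp]
    cases n with
    | zero => rw [bd_homotopyChain_zero, map_sub, precomp_idChain, sub_sub_cancel]
    | succ n =>
      -- the boundary of the previous chain is known by recursion
      rw [bd_homotopyChain n, map_sub, map_sub, precomp_idChain, ← precomp_precomp,
        precomp_faces_faces]
      simp
  rw [homotopyChain, bd_cone, key, ← subdivision]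
  abel

end Universal

/-! ### The mesh of iterated subdivisions -/

theorem dist_combine_le_sum {n m : ℕ} (p : stdSimplex ℝ (Fin n)) (w : Tuple m n)
    (y : stdSimplex ℝ (Fin m)) : dist (combine p w) y ≤ ∑ j, p j * dist (w j) y := by
  have hy : y.1 = ∑ j, p j • y.1 := by
    rw [← Finset.sum_smul, stdSimplex.sum_eq_one, one_smul]
  rw [Subtype.dist_eq, dist_eq_norm, coe_combine, hy, ← Finset.sum_sub_distrib]
  refine (norm_sum_le _ _).trans (Finset.sum_le_sum fun j _ => ?_)
  rw [← smul_sub, norm_smul, Real.norm_of_nonneg (stdSimplex.zero_le p j), Subtype.dist_eq,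
    dist_eq_norm]

theorem dist_combine_le {n m : ℕ} (p : stdSimplex ℝ (Fin n)) (w : Tuple m n)
    (y : stdSimplex ℝ (Fin m)) {r : ℝ} (h : ∀ j, dist (w j) y ≤ r) : dist (combine p w) y ≤ r :=
  calc dist (combine p w) y ≤ ∑ j, p j * dist (w j) y := dist_combine_le_sum p w y
    _ ≤ ∑ j, p j * r :=
      Finset.sum_le_sum fun j _ => mul_le_mul_of_nonneg_left (h j) (stdSimplex.zero_le p j)
    _ = r := by rw [← Finset.sum_mul, stdSimplex.sum_eq_one, one_mul]

/-- The pairwise distances of the points of a tuple are at most `r`. -/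
def Tuple.MeshLE {m n : ℕ} (w : Tuple m n) (r : ℝ) : Prop := ∀ i j, dist (w i) (w j) ≤ r

theorem Tuple.MeshLE.comp_face {m n : ℕ} {w : Tuple m (n + 1)} {r : ℝ} (h : w.MeshLE r)
    (i : Fin (n + 1)) : (w.comp (Tuple.face i)).MeshLE r := by
  intro j k
  rw [Tuple.comp_face, Tuple.comp_face]
  exact h _ _

/-- The distance between the barycenter and a vertex is an average of distances between vertices,
one of which is zero. -/
theorem Tuple.MeshLE.dist_barycenter_le {m n : ℕ} {w : Tuple m (n + 1)} {r : ℝ} (h : w.MeshLE r)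
    (l : Fin (n + 1)) : (n + 1) * dist (combine stdSimplex.barycenter w) (w l) ≤ n * r := by
  have h1 := dist_combine_le_sum stdSimplex.barycenter w (w l)
  have hb : ∀ j, (stdSimplex.barycenter : stdSimplex ℝ (Fin (n + 1))) j = ((n : ℝ) + 1)⁻¹ := by
    intro j
    change (Fintype.card (Fin (n + 1)) : ℝ)⁻¹ = _
    simp
  simp only [hb] at h1
  rw [← Finset.mul_sum, le_inv_mul_iff₀ (by positivity)] at h1
  refine h1.trans ?_
  rw [Fin.sum_univ_succAbove _ l, dist_self, zero_add]
  calc ∑ i : Fin n, dist (w (l.succAbove i)) (w l) ≤ ∑ _i : Fin n, r :=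
        Finset.sum_le_sum fun i _ => h _ _
    _ = n * r := by simp

/-- The affine maps given by `v` contract the mesh of every tuple by the factor `c`. -/
def Tuple.Contracts {m n : ℕ} (c : ℝ) (v : Tuple m n) : Prop :=
  ∀ (k : ℕ) (w : Tuple k m) (r : ℝ), w.MeshLE r → (w.comp v).MeshLE (c * r)

theorem precomp_mem_supported {P : ℕ → Type*} [AffineSimplices P] {m n : ℕ} {A : Set (P m)}
    {B : Set (Tuple m n)} {D : Set (P n)} (hD : ∀ x ∈ A, ∀ v ∈ B, act x v ∈ D) {x : Chains P m}
    (hx : x ∈ Finsupp.supported ℤ ℤ A) {a : Chains (Tuple m) n}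
    (ha : a ∈ Finsupp.supported ℤ ℤ B) : precomp x a ∈ Finsupp.supported ℤ ℤ D := by
  rw [Finsupp.supported_eq_span_single] at hx ha
  induction hx using Submodule.span_induction with
  | zero => simp
  | add x y _ _ hx hy => rw [map_add, LinearMap.add_apply]; exact add_mem hx hy
  | smul r x _ hx => rw [map_smul, LinearMap.smul_apply]; exact Submodule.smul_mem _ _ hx
  | mem x hx =>
    obtain ⟨x, hx, rfl⟩ := hx
    induction ha using Submodule.span_induction with
    | zero => simp
    | add x y _ _ hx hy => rw [map_add]; exact add_mem hx hy
    | smul r x _ hx => rw [map_smul]; exact Submodule.smul_mem _ _ hx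
    | mem a ha =>
      obtain ⟨v, hv, rfl⟩ := ha
      rw [precomp_single]
      exact Finsupp.single_mem_supported _ _ (hD x hx v hv)

theorem cone_mem_supported {m n : ℕ} (b : stdSimplex ℝ (Fin m)) {A : Set (Tuple m n)}
    {B : Set (Tuple m (n + 1))} (h : ∀ v ∈ A, v.cons b ∈ B) {c : Chains (Tuple m) n}
    (hc : c ∈ Finsupp.supported ℤ ℤ A) : cone b c ∈ Finsupp.supported ℤ ℤ B := by
  rw [Finsupp.supported_eq_span_single] at hc
  induction hc using Submodule.span_induction with
  | zero => simp
  | add x y _ _ hx hy => rw [map_add]; exact add_mem hx hy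
  | smul r x _ hx => rw [map_smul]; exact Submodule.smul_mem _ _ hx
  | mem x hx =>
    obtain ⟨x, hx, rfl⟩ := hx
    rw [cone_single]
    exact Finsupp.single_mem_supported _ _ (h x hx)

theorem faces_mem_supported (n : ℕ) :
    faces n ∈ Finsupp.supported ℤ ℤ (Set.range (Tuple.face (n := n))) :=
  sum_mem fun i _ => Finsupp.single_mem_supported _ _ ⟨i, rfl⟩

/-- The condition on `c` says that it is at least `(n - 1) / n`, the ratio between the largest
distance from the barycenter to a vertex and the mesh. It is stated for a fixed `c` and passes to
faces. -/
theorem subdivision_mem_supported {c : ℝ} (hc : 0 ≤ c) (n : ℕ) (hn : n * (1 - c) ≤ 1) :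
    subdivision n ∈ Finsupp.supported ℤ ℤ {v | v.Contracts c} := by
  induction n with
  | zero => exact Finsupp.single_mem_supported _ _ fun k w r _ i => i.elim0
  | succ n ih =>
    have hn' : n * (1 - c) ≤ 1 := by
      rcases le_total c 1 with h | h
      · push_cast at hn
        linarith
      · nlinarith [(Nat.cast_nonneg n : (0 : ℝ) ≤ n)]
    refine cone_mem_supported _ (A := {v | ∃ (i : Fin (n + 1)) (u : Tuple n n),
      u.Contracts c ∧ v = (Tuple.face i).comp u}) ?_ ?_
    · rintro _ ⟨i, u, hu, rfl⟩ k w r hw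
      have hr : 0 ≤ r := dist_nonneg.trans (hw 0 0)
      have hb : ∀ j, dist (combine stdSimplex.barycenter w) (w j) ≤ c * r := by
        intro j
        have h1 := hw.dist_barycenter_le j
        have h2 : (n : ℝ) * r ≤ (n + 1) * (c * r) := by
          push_cast at hn
          nlinarith
        exact le_of_mul_le_mul_left (h1.trans h2) (by positivity)
      rw [Tuple.comp_cons, ← Tuple.comp_assoc]
      have hv := hu k _ r (hw.comp_face i)
      have hb' : ∀ j, dist (combine stdSimplex.barycenter w)
          ((w.comp (Tuple.face i)).comp u j) ≤ c * r := by
        intro j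
        rw [dist_comm]
        refine dist_combine_le _ _ _ fun l => ?_
        rw [dist_comm, Tuple.comp_face]
        exact hb _
      intro j l
      refine Fin.cases ?_ (fun j => ?_) j <;> refine Fin.cases ?_ (fun l => ?_) l
      · rw [dist_self]; positivity
      · exact hb' l
      · rw [dist_comm]; exact hb' j
      · exact hv j l
    · refine precomp_mem_supported ?_ (faces_mem_supported n) (ih hn')
      rintro _ ⟨i, rfl⟩ u hu
      exact ⟨i, u, hu, rfl⟩

/-- The operator of barycentric subdivision on chains. -/
def Sd {P : ℕ → Type*} [AffineSimplices P] {n : ℕ} : Chains P n →ₗ[ℤ] Chains P n :=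
  precomp.flip (subdivision n)

theorem Sd_eq_precomp {P : ℕ → Type*} [AffineSimplices P] {n : ℕ} (x : Chains P n) :
    Sd x = precomp x (subdivision n) := rfl

theorem Sd_iterate_precomp {P : ℕ → Type*} [AffineSimplices P] {m n : ℕ} (x : Chains P m)
    (a : Chains (Tuple m) n) (k : ℕ) : Sd^[k] (precomp x a) = precomp x (Sd^[k] a) := by
  induction k generalizing a with
  | zero => rfl
  | succ k ih => rw [Function.iterate_succ_apply, Function.iterate_succ_apply, Sd_eq_precomp,
      precomp_precomp, ih, Sd_eq_precomp]

theorem Sd_iterate_idChain_mem_supported {c : ℝ} (hc : 0 ≤ c) (n : ℕ) (hn : n * (1 - c) ≤ 1)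
    (k : ℕ) :
    Sd^[k] (idChain n) ∈ Finsupp.supported ℤ ℤ {v | v.MeshLE (c ^ k)} := by
  induction k with
  | zero =>
    refine Finsupp.single_mem_supported _ _ fun i j => ?_
    rw [pow_zero]
    have h := Metric.dist_le_diam_of_mem (bounded_stdSimplex (Fin n))
      (stdSimplex.vertex (S := ℝ) i).2 (stdSimplex.vertex (S := ℝ) j).2
    exact h.trans diam_stdSimplex_le
  | succ k ih =>
    rw [Function.iterate_succ_apply', Sd_eq_precomp]
    refine precomp_mem_supported ?_ ih (subdivision_mem_supported hc n hn)
    intro w hw v hv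
    rw [Set.mem_ofPred_eq, pow_succ']
    exact hv _ w _ hw

theorem exists_Sd_iterate_idChain_mem_supported (n : ℕ) {δ : ℝ} (hδ : 0 < δ) :
    ∃ k, Sd^[k] (idChain n) ∈ Finsupp.supported ℤ ℤ {v | ∃ r < δ, v.MeshLE r} := by
  -- the factor `n / (n + 1)` bounds the contraction of the mesh
  have h0 : (0 : ℝ) < n + 1 := by positivity
  obtain ⟨k, hk⟩ := exists_pow_lt_of_lt_one hδ
    (show ((n : ℝ) / (n + 1)) < 1 by rw [div_lt_one h0]; linarith)
  refine ⟨k, Finsupp.supported_mono ?_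
    (Sd_iterate_idChain_mem_supported (c := n / (n + 1)) (by positivity) n ?_ k)⟩
  · exact fun v (hv : v.MeshLE _) => ⟨((n : ℝ) / (n + 1)) ^ k, hk, hv⟩
  · rw [one_sub_div h0.ne', mul_div_assoc', div_le_one h0]
    simp

/-! ### Singular simplices -/

/-- The singular simplices of `X` with `n` vertices. There is exactly one with no vertices. -/
def Simp (X : Type u) [TopologicalSpace X] (n : ℕ) : Type u := C(stdSimplex ℝ (Fin n), X)

variable {X : Type u} [TopologicalSpace X]

instance {n : ℕ} : FunLike (Simp X n) (stdSimplex ℝ (Fin n)) X :=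
  inferInstanceAs (FunLike C(stdSimplex ℝ (Fin n), X) _ _)

theorem Simp.continuous {n : ℕ} (x : Simp X n) : Continuous x := ContinuousMap.continuous x

@[ext]
theorem Simp.ext {n : ℕ} {x y : Simp X n} (h : ∀ p, x p = y p) : x = y := DFunLike.ext _ _ h

/-- The singular simplex given by a continuous map. -/
def Simp.mk {n : ℕ} (f : C(stdSimplex ℝ (Fin n), X)) : Simp X n := f

instance : AffineSimplices (Simp X) where
  act x v := Simp.mk ⟨fun p => x (combine p v), x.continuous.comp (continuous_combine v)⟩
  act_comp x v w := by
    ext p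
    exact congrArg x (Tuple.combine_comp p w v)
  act_vertices x := by
    ext p
    exact congrArg x (Tuple.combine_vertices p)

theorem Simp.act_apply {m n : ℕ} (x : Simp X m) (v : Tuple m n) (p : stdSimplex ℝ (Fin n)) :
    act x v p = x (combine p v) := rfl

/-- The singular simplices with image in `A`. -/
def simpIn (A : Set X) (n : ℕ) : Set (Simp X n) := {x | ∀ p, x p ∈ A}

/-- A Lebesgue number of the cover: a tuple of small mesh spans a simplex inside one member, as
balls are convex. -/
theorem exists_forall_mem_of_meshLE {ι : Type*} [Nonempty ι] {n : ℕ}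
    (O : ι → Set (stdSimplex ℝ (Fin n))) (hO : ∀ i, IsOpen (O i)) (hcover : ⋃ i, O i = Set.univ) :
    ∃ δ > 0, ∀ (m : ℕ) (v : Tuple n m), (∃ r < δ, v.MeshLE r) → ∃ i, ∀ p, combine p v ∈ O i := by
  obtain ⟨δ, hδ, h⟩ := lebesgue_number_lemma_of_metric (isCompact_univ) hO hcover.superset
  refine ⟨δ, hδ, fun m v => ?_⟩
  rintro ⟨r, hr, hv⟩
  cases m with
  | zero =>
    -- the simplex without vertices is empty
    refine ⟨Classical.arbitrary ι, fun p => ?_⟩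
    have hp := stdSimplex.sum_eq_one p
    simp at hp
  | succ m =>
    obtain ⟨i, hi⟩ := h (v 0) trivial
    exact ⟨i, fun p => hi ((dist_combine_le p v _ fun j => hv j 0).trans_lt hr)⟩

/-- The Lebesgue number lemma: the iterated subdivisions of a singular simplex in the union of an
excisive family are eventually made up of simplices in the members. -/
theorem IsExcisive.exists_Sd_iterate_mem {ι : Type*} [Nonempty ι] {V : ι → Set X}
    (hV : IsExcisive V) {n : ℕ} {x : Simp X n} (hx : x ∈ simpIn (⋃ i, V i) n) :
    ∃ k, Sd^[k] (Finsupp.single x 1) ∈ Finsupp.supported ℤ ℤ (⋃ i, simpIn (V i) n) := by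
  let y : stdSimplex ℝ (Fin n) → (⋃ i, V i : Set X) := fun p => ⟨x p, hx p⟩
  have hy : Continuous y := x.continuous.subtype_mk _
  obtain ⟨δ, hδ, h⟩ := exists_forall_mem_of_meshLE
    (fun i => y ⁻¹' interior (Subtype.val ⁻¹' V i)) (fun i => isOpen_interior.preimage hy) (by
      refine Set.eq_univ_of_forall fun p => ?_
      have hp := hx p
      rw [hV, Set.mem_iUnion] at hp
      obtain ⟨i, z, hz, hzp⟩ := hp
      refine Set.mem_iUnion.2 ⟨i, ?_⟩
      have : y p = z := Subtype.ext hzp.symm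
      rwa [Set.mem_preimage, this])
  obtain ⟨k, hk⟩ := exists_Sd_iterate_idChain_mem_supported n hδ
  refine ⟨k, ?_⟩
  rw [← precomp_idChain (Finsupp.single x (1 : ℤ)), Sd_iterate_precomp]
  refine precomp_mem_supported ?_ (Finsupp.single_mem_supported ℤ (1 : ℤ) (Set.mem_singleton x)) hk
  rintro _ rfl v hv
  obtain ⟨i, hi⟩ := h n v hv
  exact Set.mem_iUnion.2 ⟨i, fun p => interior_subset (s := Subtype.val ⁻¹' V i) (hi p)⟩

/-! ### Homology of families of simplices -/

/-- Two subquotients `Z / B` and `Z' / B'` are isomorphic if a module `G` maps to both, onto modulo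
`B` and `B'`, with the same preimages of `B` and `B'`. -/
theorem nonempty_subquotient_equiv {G M M' : Type*} [AddCommGroup G] [AddCommGroup M]
    [AddCommGroup M'] {Z B : Submodule ℤ M} {Z' B' : Submodule ℤ M'} (f : G →ₗ[ℤ] M)
    (f' : G →ₗ[ℤ] M') (hf : ∀ g, f g ∈ Z) (hf' : ∀ g, f' g ∈ Z')
    (hs : ∀ z ∈ Z, ∃ g, z - f g ∈ B) (hs' : ∀ z ∈ Z', ∃ g, z - f' g ∈ B')
    (hB : ∀ g, f g ∈ B ↔ f' g ∈ B') :
    Nonempty ((Z ⧸ B.submoduleOf Z) ≃ₗ[ℤ] (Z' ⧸ B'.submoduleOf Z')) := by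
  let F : G →ₗ[ℤ] Z ⧸ B.submoduleOf Z := (B.submoduleOf Z).mkQ ∘ₗ f.codRestrict Z hf
  let F' : G →ₗ[ℤ] Z' ⧸ B'.submoduleOf Z' := (B'.submoduleOf Z').mkQ ∘ₗ f'.codRestrict Z' hf'
  have hF : Function.Surjective F := by
    intro z
    obtain ⟨z, rfl⟩ := Submodule.mkQ_surjective _ z
    obtain ⟨g, hg⟩ := hs z z.2
    exact ⟨g, ((Submodule.Quotient.eq (p := B.submoduleOf Z) (x := z) (y := f.codRestrict Z hf g)).2
      hg).symm⟩
  have hF' : Function.Surjective F' := by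
    intro z
    obtain ⟨z, rfl⟩ := Submodule.mkQ_surjective _ z
    obtain ⟨g, hg⟩ := hs' z z.2
    exact ⟨g, ((Submodule.Quotient.eq (p := B'.submoduleOf Z') (x := z)
      (y := f'.codRestrict Z' hf' g)).2 hg).symm⟩
  have hk : LinearMap.ker F = LinearMap.ker F' := by
    ext g
    have h1 : g ∈ LinearMap.ker F ↔ f g ∈ B := Submodule.Quotient.mk_eq_zero _
    have h2 : g ∈ LinearMap.ker F' ↔ f' g ∈ B' := Submodule.Quotient.mk_eq_zero _
    rw [h1, h2, hB]
  exact ⟨(F.quotKerEquivOfSurjective hF).symm.trans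
    ((Submodule.quotEquivOfEq _ _ hk).trans (F'.quotKerEquivOfSurjective hF'))⟩

section Family

variable {P : ℕ → Type u} {Q Q' : ∀ n, Set (P n)}

/-- The chains on the simplices of the family `Q`. -/
def chainsIn (Q : ∀ n, Set (P n)) (n : ℕ) : Submodule ℤ (Chains P n) :=
  Finsupp.supported ℤ ℤ (Q n)

theorem chainsIn_mono (h : Q ≤ Q') (n : ℕ) : chainsIn Q n ≤ chainsIn Q' n :=
  Finsupp.supported_mono (h n)

theorem chainsIn_sup (n : ℕ) : chainsIn (Q ⊔ Q') n = chainsIn Q n ⊔ chainsIn Q' n :=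
  Finsupp.supported_union _ _

theorem chainsIn_inf (n : ℕ) : chainsIn (Q ⊓ Q') n = chainsIn Q n ⊓ chainsIn Q' n :=
  Finsupp.supported_inter _ _

variable [AffineSimplices P]

/-- A family of sets of simplices which is closed under precomposition with affine maps. -/
def IsStable (Q : ∀ n, Set (P n)) : Prop :=
  ∀ ⦃m n : ℕ⦄ (x : P m) (v : Tuple m n), x ∈ Q m → act x v ∈ Q n

/-- The cycles of the family `Q`; all chains with no vertices are cycles. -/
def cyclesIn (Q : ∀ n, Set (P n)) : ∀ n : ℕ, Submodule ℤ (Chains P n)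
  | 0 => chainsIn Q 0
  | n + 1 => chainsIn Q (n + 1) ⊓ LinearMap.ker bd

/-- The boundaries of chains of the family `Q`. -/
def boundariesIn (Q : ∀ n, Set (P n)) (n : ℕ) : Submodule ℤ (Chains P n) :=
  (chainsIn Q (n + 1)).map bd

/-- The homology of the chains on the family `Q`, at the chains on simplices with `n` vertices. -/
abbrev HomologyIn (Q : ∀ n, Set (P n)) (n : ℕ) : Type u :=
  cyclesIn Q n ⧸ (boundariesIn Q n).submoduleOf (cyclesIn Q n)

/-- The homology of the chains on the family `Q`, indexed by the dimension of simplices. -/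
def HIn (Q : ∀ n, Set (P n)) : ℤ → AddCommGrpCat.{u}
  | Int.ofNat n => AddCommGrpCat.of (HomologyIn Q (n + 1))
  | Int.negSucc 0 => AddCommGrpCat.of (HomologyIn Q 0)
  | Int.negSucc (_ + 1) => AddCommGrpCat.of PUnit.{u + 1}

/-- All cycles of the family `Q` are boundaries, including the chains with no vertices. -/
def AcyclicIn (Q : ∀ n, Set (P n)) : Prop := ∀ n, cyclesIn Q n ≤ boundariesIn Q n

theorem mem_cyclesIn_succ {n : ℕ} {z : Chains P (n + 1)} :
    z ∈ cyclesIn Q (n + 1) ↔ z ∈ chainsIn Q (n + 1) ∧ bd z = 0 := Iff.rfl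

theorem cyclesIn_le (n : ℕ) : cyclesIn Q n ≤ chainsIn Q n := by
  cases n with
  | zero => exact le_rfl
  | succ n => exact inf_le_left

theorem mem_boundariesIn {n : ℕ} {z : Chains P n} :
    z ∈ boundariesIn Q n ↔ ∃ w ∈ chainsIn Q (n + 1), bd w = z := Iff.rfl

theorem IsStable.precomp_mem (hQ : IsStable Q) {m n : ℕ} {x : Chains P m} (hx : x ∈ chainsIn Q m)
    (a : Chains (Tuple m) n) : precomp x a ∈ chainsIn Q n :=
  precomp_mem_supported (B := Set.univ) (fun x hx v _ => hQ x v hx) hx (by simp)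

theorem IsStable.bd_mem (hQ : IsStable Q) {n : ℕ} {x : Chains P (n + 1)}
    (hx : x ∈ chainsIn Q (n + 1)) : bd x ∈ chainsIn Q n :=
  hQ.precomp_mem hx _

theorem IsStable.inf (hQ : IsStable Q) (hQ' : IsStable Q') : IsStable (Q ⊓ Q') :=
  fun _ _ x v hx => ⟨hQ x v hx.1, hQ' x v hx.2⟩

theorem IsStable.iSup {ι : Sort*} {R : ι → ∀ n, Set (P n)} (h : ∀ i, IsStable (R i)) :
    IsStable (⨆ i, R i) := by
  intro m n x v hx
  simp only [iSup_apply, Set.iSup_eq_iUnion, Set.mem_iUnion] at hx ⊢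
  obtain ⟨i, hi⟩ := hx
  exact ⟨i, h i x v hi⟩

theorem AcyclicIn.subsingleton (h : AcyclicIn Q) (n : ℕ) : Subsingleton (HomologyIn Q n) := by
  rw [Submodule.Quotient.subsingleton_iff, eq_top_iff]
  exact fun z _ => h n z.2

theorem isZero_HIn_iff : (∀ q, IsZero (HIn Q q)) ↔ AcyclicIn Q := by
  constructor
  · intro h n z hz
    have hs : Subsingleton (HomologyIn Q n) := by
      cases n with
      | zero => exact AddCommGrpCat.subsingleton_of_isZero (h (Int.negSucc 0))
      | succ n => exact AddCommGrpCat.subsingleton_of_isZero (h (Int.ofNat n))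
    rw [Submodule.Quotient.subsingleton_iff, eq_top_iff] at hs
    exact hs (x := ⟨z, hz⟩) trivial
  · intro h q
    match q with
    | Int.ofNat n =>
      have := h.subsingleton (n + 1)
      exact AddCommGrpCat.isZero_of_subsingleton (AddCommGrpCat.of (HomologyIn Q (n + 1)))
    | Int.negSucc 0 =>
      have := h.subsingleton 0
      exact AddCommGrpCat.isZero_of_subsingleton (AddCommGrpCat.of (HomologyIn Q 0))
    | Int.negSucc (_ + 1) =>
      exact AddCommGrpCat.isZero_of_subsingleton (AddCommGrpCat.of PUnit.{u + 1})

theorem nonempty_iso_of_linearEquiv {A B : Type u} [AddCommGroup A] [AddCommGroup B]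
    (h : Nonempty (A ≃ₗ[ℤ] B)) : Nonempty (AddCommGrpCat.of A ≅ AddCommGrpCat.of B) :=
  h.map fun e => e.toAddEquiv.toAddCommGrpIso

/-- It is enough to compare the homology groups at each number of vertices. -/
theorem nonempty_HIn_iso {P' : ℕ → Type u} [AffineSimplices P'] {R : ∀ n, Set (P' n)}
    (h : ∀ n, Nonempty (HomologyIn Q n ≃ₗ[ℤ] HomologyIn R n)) (q : ℤ) :
    Nonempty (HIn Q q ≅ HIn R q) :=
  match q with
  | Int.ofNat n => nonempty_iso_of_linearEquiv (h (n + 1))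
  | Int.negSucc 0 => nonempty_iso_of_linearEquiv (h 0)
  | Int.negSucc (_ + 1) => ⟨Iso.refl _⟩

/-! ### Small chains -/

/-- If the boundary of `z` and some iterated subdivision of `z` are chains of `Q`, then so is `z`,
up to a boundary. The bounding chain comes from the homotopy between subdivision and the identity,
and is a reparametrisation of `z`. -/
theorem exists_sub_bd_mem_of_Sd_iterate (hQ : IsStable Q) {n : ℕ} (k : ℕ) :
    ∀ z : Chains P (n + 1), bd z ∈ chainsIn Q n → Sd^[k] z ∈ chainsIn Q (n + 1) →
      ∃ a : Chains (Tuple (n + 1)) (n + 2), z - bd (precomp z a) ∈ chainsIn Q (n + 1) := by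
  induction k with
  | zero => exact fun z _ hz => ⟨0, by simpa using hz⟩
  | succ k ih =>
    intro z hz hk
    have hS : bd (Sd z) = Sd (bd z) := by
      rw [Sd_eq_precomp, Sd_eq_precomp, bd_precomp, bd_subdivision, bd_eq_precomp, precomp_precomp]
    obtain ⟨a, hw⟩ := ih (Sd z) (hS ▸ hQ.precomp_mem hz _) hk
    refine ⟨precomp (subdivision _) a + homotopyChain _, ?_⟩
    have hT : bd (precomp z (homotopyChain (n + 1))) =
        z - Sd z - precomp (bd z) (homotopyChain n) := by
      rw [bd_precomp, bd_homotopyChain, map_sub, map_sub, precomp_idChain, bd_eq_precomp,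
        precomp_precomp, Sd_eq_precomp]
    rw [map_add, map_add, hT, ← precomp_precomp, ← Sd_eq_precomp]
    have : z - (bd (precomp (Sd z) a) + (z - Sd z - precomp (bd z) (homotopyChain n))) =
        (Sd z - bd (precomp (Sd z) a)) + precomp (bd z) (homotopyChain n) := by abel
    rw [this]
    exact add_mem hw (hQ.precomp_mem hz _)

theorem IsStable.Sd_iterate_mem (hQ : IsStable Q) {n : ℕ} {z : Chains P n}
    (hz : z ∈ chainsIn Q n) (k : ℕ) : Sd^[k] z ∈ chainsIn Q n := by
  induction k with
  | zero => exact hz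
  | succ k ih => rw [Function.iterate_succ_apply']; exact hQ.precomp_mem ih _

theorem exists_Sd_iterate_mem (hQ : IsStable Q)
    (h : ∀ n, ∀ x ∈ Q' n, ∃ k, Sd^[k] (Finsupp.single x 1) ∈ chainsIn Q n) {n : ℕ}
    {z : Chains P n} (hz : z ∈ chainsIn Q' n) : ∃ k, Sd^[k] z ∈ chainsIn Q n := by
  rw [chainsIn, Finsupp.supported_eq_span_single] at hz
  induction hz using Submodule.span_induction with
  | zero => exact ⟨0, zero_mem _⟩
  | mem z hz =>
    obtain ⟨x, hx, rfl⟩ := hz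
    exact h n x hx
  | add x y _ _ hx hy =>
    obtain ⟨k, hk⟩ := hx
    obtain ⟨l, hl⟩ := hy
    refine ⟨k + l, ?_⟩
    rw [iterate_map_add]
    refine add_mem ?_ ?_
    · rw [add_comm, Function.iterate_add_apply]
      exact hQ.Sd_iterate_mem hk l
    · rw [Function.iterate_add_apply]
      exact hQ.Sd_iterate_mem hl k
  | smul r x _ hx =>
    obtain ⟨k, hk⟩ := hx
    refine ⟨k, ?_⟩
    rw [iterate_map_zsmul]
    exact Submodule.smul_mem _ _ hk

/-- If the simplices of `Q'` become chains of the smaller family `Q` after subdivision, then the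
two families have the same homology. -/
theorem nonempty_HIn_iso_of_Sd (hQ : IsStable Q) (hQ' : IsStable Q') (hle : Q ≤ Q')
    (h : ∀ n, ∀ x ∈ Q' n, ∃ k, Sd^[k] (Finsupp.single x 1) ∈ chainsIn Q n) (q : ℤ) :
    Nonempty (HIn Q q ≅ HIn Q' q) := by
  have key : ∀ n (z : Chains P (n + 1)), z ∈ chainsIn Q' (n + 1) → bd z ∈ chainsIn Q n →
      ∃ w ∈ chainsIn Q' (n + 2), z - bd w ∈ chainsIn Q (n + 1) := by
    intro n z hz hbz
    obtain ⟨k, hk⟩ := exists_Sd_iterate_mem hQ h hz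
    obtain ⟨a, hw⟩ := exists_sub_bd_mem_of_Sd_iterate hQ k z hbz hk
    exact ⟨_, hQ'.precomp_mem hz a, hw⟩
  -- subdivision does nothing to chains without vertices
  have h0 : chainsIn Q' 0 ≤ chainsIn Q 0 := by
    intro z hz
    obtain ⟨k, hk⟩ := exists_Sd_iterate_mem hQ h hz
    have hS : ∀ x : Chains P 0, Sd x = x := precomp_idChain
    rwa [Function.iterate_fixed (hS z)] at hk
  have hZ : ∀ n, cyclesIn Q n ≤ cyclesIn Q' n := by
    intro n
    cases n with
    | zero => exact chainsIn_mono hle 0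
    | succ n => exact inf_le_inf_right _ (chainsIn_mono hle _)
  refine nonempty_HIn_iso (fun n => nonempty_subquotient_equiv (cyclesIn Q n).subtype
    (cyclesIn Q n).subtype (fun g => g.2) (fun g => hZ n g.2) (fun z hz => ⟨⟨z, hz⟩, by simp⟩)
    ?_ ?_) q
  · intro z hz
    cases n with
    | zero => exact ⟨⟨z, h0 hz⟩, by simp⟩
    | succ n =>
      obtain ⟨w, hw, hzw⟩ := key n z hz.1 (by rw [LinearMap.mem_ker.1 hz.2]; exact zero_mem _)
      refine ⟨⟨z - bd w, hzw, ?_⟩, ?_⟩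
      · exact LinearMap.mem_ker.2 (by rw [map_sub, bd_bd, LinearMap.mem_ker.1 hz.2, sub_zero])
      · simpa using mem_boundariesIn.2 ⟨w, hw, rfl⟩
  · rintro ⟨z, hz⟩
    constructor
    · exact fun hz => Submodule.map_mono (chainsIn_mono hle _) hz
    · rintro ⟨w, hw, hwz : bd w = z⟩
      obtain ⟨v, -, hv⟩ := key n w hw (by rw [hwz]; exact cyclesIn_le n hz)
      exact ⟨w - bd v, hv, by rw [map_sub, bd_bd, sub_zero]; exact hwz⟩

/-! ### Mayer–Vietoris for acyclic families -/

/-- The connecting isomorphism takes the class of a cycle `a + b` to the class of the boundary of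
`a`. -/
theorem nonempty_homologyIn_sup_equiv (hQ : IsStable Q) (hQ' : IsStable Q') (h : AcyclicIn Q)
    (h' : AcyclicIn Q') (n : ℕ) :
    Nonempty (HomologyIn (Q ⊔ Q') (n + 1) ≃ₗ[ℤ] HomologyIn (Q ⊓ Q') n) := by
  let s : chainsIn Q (n + 1) × chainsIn Q' (n + 1) →ₗ[ℤ] Chains P (n + 1) :=
    (chainsIn Q (n + 1)).subtype.coprod (chainsIn Q' (n + 1)).subtype
  -- pairs of chains whose sum is a cycle
  let G := LinearMap.ker (bd ∘ₗ s)
  have hG : ∀ g : G, bd (g.1.1 : Chains P (n + 1)) + bd (g.1.2 : Chains P (n + 1)) = 0 := by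
    intro g
    rw [← map_add]
    exact g.2
  refine nonempty_subquotient_equiv (s ∘ₗ G.subtype)
    (bd ∘ₗ (chainsIn Q (n + 1)).subtype ∘ₗ LinearMap.fst ℤ _ _ ∘ₗ G.subtype) ?_ ?_ ?_ ?_ ?_
  · intro g
    refine mem_cyclesIn_succ.2 ⟨?_, g.2⟩
    rw [chainsIn_sup]
    exact Submodule.add_mem_sup g.1.1.2 g.1.2.2
  · intro g
    have hmem : bd (g.1.1 : Chains P (n + 1)) ∈ chainsIn (Q ⊓ Q') n := by
      rw [chainsIn_inf]
      refine ⟨hQ.bd_mem g.1.1.2, ?_⟩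
      rw [eq_neg_of_add_eq_zero_left (hG g)]
      exact neg_mem (hQ'.bd_mem g.1.2.2)
    cases n with
    | zero => exact hmem
    | succ n => exact ⟨hmem, bd_bd _⟩
  · rintro z ⟨hz, hz0⟩
    rw [chainsIn_sup] at hz
    obtain ⟨a, ha, b, hb, rfl⟩ := Submodule.mem_sup.1 hz
    refine ⟨⟨(⟨a, ha⟩, ⟨b, hb⟩), hz0⟩, ?_⟩
    have : a + b - s (⟨a, ha⟩, ⟨b, hb⟩) = 0 := sub_self _
    exact this ▸ zero_mem _
  · intro z hz
    have h1 : z ∈ cyclesIn Q n ∧ z ∈ cyclesIn Q' n := by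
      cases n with
      | zero => rwa [cyclesIn, chainsIn_inf] at hz
      | succ n =>
        obtain ⟨hz, hz0⟩ := hz
        rw [chainsIn_inf] at hz
        exact ⟨⟨hz.1, hz0⟩, ⟨hz.2, hz0⟩⟩
    obtain ⟨a, ha, haz⟩ := h n h1.1
    obtain ⟨b, hb, hbz⟩ := h' n h1.2
    refine ⟨⟨(⟨a, ha⟩, ⟨-b, neg_mem hb⟩), ?_⟩, ?_⟩
    · change bd (a + -b) = 0
      rw [map_add, map_neg, haz, hbz, add_neg_cancel]
    · change z - bd a ∈ _
      rw [haz, sub_self]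
      exact zero_mem _
  · rintro ⟨⟨⟨a, ha⟩, ⟨b, hb⟩⟩, hab⟩
    replace hab : bd (a + b) = 0 := hab
    change a + b ∈ boundariesIn (Q ⊔ Q') (n + 1) ↔ bd a ∈ boundariesIn (Q ⊓ Q') n
    rw [map_add] at hab
    constructor
    · rintro ⟨w, hw, hwab⟩
      rw [SetLike.mem_coe, chainsIn_sup] at hw
      obtain ⟨u, hu, v, hv, rfl⟩ := Submodule.mem_sup.1 hw
      refine ⟨a - bd u, ?_, by rw [map_sub, bd_bd, sub_zero]⟩
      rw [SetLike.mem_coe, chainsIn_inf]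
      refine ⟨sub_mem ha (hQ.bd_mem hu), ?_⟩
      have : a - bd u = bd v - b := by
        rw [map_add] at hwab
        rw [sub_eq_sub_iff_add_eq_add, ← hwab]
        exact add_comm _ _
      rw [this]
      exact sub_mem (hQ'.bd_mem hv) hb
    · rintro ⟨c, hc, hca⟩
      rw [SetLike.mem_coe, chainsIn_inf] at hc
      obtain ⟨u, hu, hua⟩ := h (n + 1) (x := a - c)
        ⟨sub_mem ha hc.1, LinearMap.mem_ker.2 (by rw [map_sub, hca, sub_self])⟩
      obtain ⟨v, hv, hvb⟩ := h' (n + 1) (x := b + c)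
        ⟨add_mem hb hc.2, LinearMap.mem_ker.2 (by rw [map_add, hca, add_comm, hab])⟩
      refine ⟨u + v, ?_, ?_⟩
      · rw [SetLike.mem_coe, chainsIn_sup]
        exact Submodule.add_mem_sup hu hv
      · rw [map_add, hua, hvb]
        abel

theorem AcyclicIn.cyclesIn_sup_zero_le (h : AcyclicIn Q) (h' : AcyclicIn Q') :
    cyclesIn (Q ⊔ Q') 0 ≤ boundariesIn (Q ⊔ Q') 0 := by
  rw [cyclesIn, chainsIn_sup, boundariesIn, chainsIn_sup, Submodule.map_sup]
  exact sup_le_sup (h 0) (h' 0)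

theorem nonempty_HIn_sup_iso (hQ : IsStable Q) (hQ' : IsStable Q') (h : AcyclicIn Q)
    (h' : AcyclicIn Q') (q : ℤ) : Nonempty (HIn (Q ⊔ Q') q ≅ HIn (Q ⊓ Q') (q - 1)) := by
  match q with
  | Int.ofNat (n + 1) =>
    have hn : Int.ofNat (n + 1) - 1 = Int.ofNat n := by simp
    rw [hn]
    exact nonempty_iso_of_linearEquiv (nonempty_homologyIn_sup_equiv hQ hQ' h h' (n + 1))
  | Int.ofNat 0 =>
    exact nonempty_iso_of_linearEquiv (nonempty_homologyIn_sup_equiv hQ hQ' h h' 0)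
  | Int.negSucc 0 =>
    have : Subsingleton (HomologyIn (Q ⊔ Q') 0) := by
      rw [Submodule.Quotient.subsingleton_iff, eq_top_iff]
      exact fun z _ => h.cyclesIn_sup_zero_le h' z.2
    exact ⟨(AddCommGrpCat.isZero_of_subsingleton (AddCommGrpCat.of (HomologyIn (Q ⊔ Q') 0))).iso
      (AddCommGrpCat.isZero_of_subsingleton (AddCommGrpCat.of PUnit.{u + 1}))⟩
  | Int.negSucc (n + 1) => exact ⟨Iso.refl (AddCommGrpCat.of PUnit.{u + 1})⟩

/-- Induction on `k`: for `θ = insert a θ'` the union over `θ'` is acyclic by the induction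
hypothesis, and its intersection with `R a` is the union of the `k + 1` families `R i ⊓ R a`, to
which the induction hypothesis applies again. -/
theorem nonempty_HIn_iSup_iso {S : Type*} (k : ℕ) :
    ∀ (R : S → ∀ n, Set (P n)) (θ : Finset S), (∀ i, IsStable (R i)) → θ.card = k + 1 →
      (∀ σ ⊆ θ, σ.Nonempty → σ.card ≤ k → AcyclicIn (⨅ i ∈ σ, R i)) →
      ∀ q : ℤ, Nonempty (HIn (⨆ i ∈ θ, R i) q ≅ HIn (⨅ i ∈ θ, R i) (q - k)) := by
  classical
  induction k with
  | zero =>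
    intro R θ _ hθ _ q
    obtain ⟨a, rfl⟩ := Finset.card_eq_one.1 hθ
    simp only [Finset.mem_singleton, iSup_iSup_eq_left, iInf_iInf_eq_left, Nat.cast_zero, sub_zero]
    exact ⟨Iso.refl _⟩
  | succ k ih =>
    intro R θ hR hθ hA q
    obtain ⟨a, θ', ha, rfl, hθ'⟩ := Finset.card_eq_succ.1 hθ
    have hne : θ'.Nonempty := Finset.card_pos.1 (by omega)
    have hsub : ∀ σ ⊆ θ', σ.Nonempty → σ.card ≤ k + 1 → AcyclicIn (⨅ i ∈ σ, R i) :=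
      fun σ hσ hn hc => hA σ (hσ.trans (Finset.subset_insert _ _)) hn hc
    have hK : AcyclicIn (⨆ i ∈ θ', R i) := by
      rw [← isZero_HIn_iff]
      intro q
      obtain ⟨e⟩ := ih R θ' hR hθ' (fun σ hσ hn hc => hsub σ hσ hn (by omega)) q
      exact (isZero_HIn_iff.2 (hsub θ' subset_rfl hne hθ'.le) _).of_iso e
    have hL : AcyclicIn (R a) := by
      simpa using hA {a} (by simp) (Finset.singleton_nonempty a) (by simp)
    have hinf : ∀ σ : Finset S, σ.Nonempty →
        ⨅ i ∈ σ, (R i ⊓ R a) = ⨅ i ∈ insert a σ, R i := by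
      intro σ hσ
      rw [Finset.iInf_insert, inf_comm (R a)]
      exact (biInf_inf (p := (· ∈ σ)) (f := fun i _ => R i) hσ).symm
    obtain ⟨e₁⟩ := nonempty_HIn_sup_iso
      (IsStable.iSup fun i => IsStable.iSup fun _ : i ∈ θ' => hR i) (hR a) hK hL q
    obtain ⟨e₂⟩ := ih (fun i => R i ⊓ R a) θ' (fun i => (hR i).inf (hR a)) hθ'
      (fun σ hσ hn hc => by
        rw [hinf σ hn]
        exact hA _ (Finset.insert_subset_insert _ hσ) (Finset.insert_nonempty _ _)
          ((Finset.card_insert_le _ _).trans (by omega))) (q - 1)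
    have hsup : ⨆ i ∈ θ', (R i ⊓ R a) = (⨆ i ∈ θ', R i) ⊓ R a := by
      simp only [iSup_inf_eq]
    rw [hinf θ' hne, hsup] at e₂
    rw [Finset.iSup_insert, sup_comm]
    have hq : q - 1 - (k : ℤ) = q - ((k + 1 : ℕ) : ℤ) := by push_cast; ring
    rw [hq] at e₂
    exact ⟨e₁ ≪≫ e₂⟩

end Family

/-! ### Comparison with the augmented singular chain complex -/

section Coproduct

variable {T T' : Type u}

theorem coeff_hom_ext {A : AddCommGrpCat.{u}} {f g : coeff.{u} ⟶ A}
    (h : f (ULift.up 1) = g (ULift.up 1)) : f = g := by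
  have h' : (f.hom.comp AddEquiv.ulift.symm.toAddMonoidHom) =
      g.hom.comp AddEquiv.ulift.symm.toAddMonoidHom := AddMonoidHom.ext_int h
  ext z
  exact DFunLike.congr_fun h' z.down

/-- The homomorphism `ℤ → (T →₀ ℤ)` onto the summand of `x`. -/
def singleHom (x : T) : coeff.{u} ⟶ AddCommGrpCat.of (T →₀ ℤ) :=
  AddCommGrpCat.ofHom ((Finsupp.singleAddHom x).comp AddEquiv.ulift.toAddMonoidHom)

/-- The coproduct of copies of `ℤ` as a group of finitely supported functions. -/
def coprodToFinsupp (T : Type u) : (∐ fun _ : T => coeff.{u}) ⟶ AddCommGrpCat.of (T →₀ ℤ) :=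
  Sigma.desc singleHom

theorem ι_coprodToFinsupp (x : T) :
    Sigma.ι (fun _ : T => coeff.{u}) x ≫ coprodToFinsupp T = singleHom x :=
  Sigma.ι_desc _ _

theorem coprodToFinsupp_bijective (T : Type u) : Function.Bijective (coprodToFinsupp T) := by
  let ψ : AddCommGrpCat.of (T →₀ ℤ) ⟶ ∐ fun _ : T => coeff.{u} :=
    AddCommGrpCat.ofHom (Finsupp.liftAddHom fun x =>
      (Sigma.ι (fun _ : T => coeff.{u}) x).hom.comp AddEquiv.ulift.symm.toAddMonoidHom)
  have hψ : ∀ (x : T) (r : ℤ), ψ (Finsupp.single x r) =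
      Sigma.ι (fun _ : T => coeff.{u}) x (ULift.up r) := fun x r =>
    Finsupp.liftAddHom_apply_single _ _ _
  have h1 : coprodToFinsupp T ≫ ψ = 𝟙 _ := by
    refine Sigma.hom_ext _ _ fun x => ?_
    rw [← Category.assoc, ι_coprodToFinsupp, Category.comp_id]
    ext z
    exact hψ x z.down
  have h2 : ψ ≫ coprodToFinsupp T = 𝟙 _ := by
    refine AddCommGrpCat.hom_ext (Finsupp.addHom_ext fun x r => ?_)
    change coprodToFinsupp T (ψ (Finsupp.single x r)) = _
    rw [hψ, ← ConcreteCategory.comp_apply, ι_coprodToFinsupp]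
    rfl
  have : IsIso (coprodToFinsupp T) := ⟨ψ, h1, h2⟩
  exact ConcreteCategory.bijective_of_isIso (coprodToFinsupp T)

end Coproduct

/-- The homology of a chain complex of abelian groups which is isomorphic, degree by degree, to the
chains on a family of simplices. -/
theorem nonempty_homology_iso {P : ℕ → Type u} [AffineSimplices P] {Q : ∀ n, Set (P n)}
    (K : ChainComplex AddCommGrpCat.{u} ℕ) (φ : ∀ n, K.X n ⟶ AddCommGrpCat.of (Chains P n))
    (hφ : ∀ n, Function.Injective (φ n)) (hr : ∀ n c, c ∈ chainsIn Q n ↔ ∃ z, φ n z = c)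
    (hd : ∀ n (z : K.X (n + 1)), φ n (K.d (n + 1) n z) = bd (φ (n + 1) z : Chains P (n + 1)))
    (n : ℕ) : Nonempty (K.homology n ≅ AddCommGrpCat.of (HomologyIn Q n)) := by
  obtain ⟨k, hk⟩ : ∃ k, (ComplexShape.down ℕ).next n = k := ⟨_, rfl⟩
  -- for `n = 0` the index `k` is again `0`, and the differential is zero
  let e := K.homologyIsoSc' (n + 1) n k (ChainComplex.prev ℕ n) hk
  let Sc := K.sc' (n + 1) n k
  have hcyc : ∀ z : K.X n, φ n z ∈ cyclesIn Q n ↔ K.d n k z = 0 := by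
    intro z
    cases n with
    | zero =>
      have : K.d 0 k = 0 := K.shape _ _ (by simp)
      rw [this]
      exact ⟨fun _ => rfl, fun _ => (hr 0 _).2 ⟨z, rfl⟩⟩
    | succ n =>
      obtain rfl : n = k := by rw [← hk, ChainComplex.next_nat_succ]
      rw [mem_cyclesIn_succ, ← hd]
      constructor
      · intro h
        exact hφ n (h.2.trans (map_zero (φ n).hom).symm)
      · intro h
        refine ⟨(hr _ _).2 ⟨z, rfl⟩, ?_⟩
        rw [h]
        exact map_zero (φ n).hom
  let f : AddMonoidHom.ker Sc.g.hom →ₗ[ℤ] Chains P n :=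
    ((φ n).hom.comp (AddMonoidHom.ker Sc.g.hom).subtype).toIntLinearMap
  have hf : ∀ z, f z ∈ cyclesIn Q n := fun z => (hcyc z.1).2 z.2
  let F : AddMonoidHom.ker Sc.g.hom →+ HomologyIn Q n :=
    (((boundariesIn Q n).submoduleOf (cyclesIn Q n)).mkQ ∘ₗ f.codRestrict _ hf).toAddMonoidHom
  have hF : Function.Surjective F := by
    intro c
    obtain ⟨⟨c, hc⟩, rfl⟩ := Submodule.mkQ_surjective _ c
    obtain ⟨z, rfl⟩ := (hr n c).1 (cyclesIn_le n hc)
    exact ⟨⟨z, (hcyc z).1 hc⟩, rfl⟩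
  have hk : AddMonoidHom.range Sc.abToCycles = F.ker := by
    ext z
    have h1 : z ∈ F.ker ↔ φ n z.1 ∈ boundariesIn Q n := Submodule.Quotient.mk_eq_zero _
    rw [h1, mem_boundariesIn]
    constructor
    · rintro ⟨w, rfl⟩
      exact ⟨φ (n + 1) w, (hr _ _).2 ⟨w, rfl⟩, (hd n w).symm⟩
    · rintro ⟨_, hw, hwz⟩
      obtain ⟨w, rfl⟩ := (hr _ _).1 hw
      refine ⟨w, Subtype.ext (hφ n ?_)⟩
      rw [← hwz]
      exact hd n w
  let E : (AddMonoidHom.ker Sc.g.hom ⧸ AddMonoidHom.range Sc.abToCycles) ≃+ HomologyIn Q n :=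
    (QuotientAddGroup.quotientAddEquivOfEq hk).trans
      (QuotientAddGroup.quotientKerEquivOfSurjective F hF)
  exact ⟨e ≪≫ Sc.abHomologyIso ≪≫ E.toAddCommGrpIso⟩

/-- A simplex of the singular simplicial set of the subspace `A`, as a singular simplex of `X`. -/
def inclSimp (A : Set X) (n : ℕ)
    (x : (TopCat.toSSet.obj (TopCat.of A)).obj (Opposite.op (SimplexCategory.mk n))) :
    Simp X (n + 1) :=
  Simp.mk ((⟨Subtype.val, continuous_subtype_val⟩ : C(A, X)).comp (TopCat.toSSetObjEquiv _ _ x))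

theorem inclSimp_injective (A : Set X) (n : ℕ) : Function.Injective (inclSimp A n) := by
  intro x y h
  refine (TopCat.toSSetObjEquiv _ _).injective (ContinuousMap.ext fun p => Subtype.ext ?_)
  exact DFunLike.congr_fun h p

theorem range_inclSimp (A : Set X) (n : ℕ) : Set.range (inclSimp A n) = simpIn A (n + 1) := by
  ext x
  constructor
  · rintro ⟨y, rfl⟩ p
    exact Subtype.coe_prop _
  · intro hx
    refine ⟨(TopCat.toSSetObjEquiv (TopCat.of A) _).symm
      ⟨fun p => ⟨x p, hx p⟩, x.continuous.subtype_mk _⟩, ?_⟩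
    rfl

theorem combine_face {n : ℕ} (i : Fin (n + 1)) (p : stdSimplex ℝ (Fin n)) :
    combine p (Tuple.face i) = stdSimplex.map i.succAbove p := by
  ext l
  rw [stdSimplex.map_coe, FunOnFinite.linearMap_apply_apply, combine_apply, Finset.sum_filter]
  refine Finset.sum_congr rfl fun j _ => ?_
  simp [Tuple.face, Pi.single_apply, eq_comm]

theorem inclSimp_δ (A : Set X) (n : ℕ) (i : Fin (n + 2))
    (x : (TopCat.toSSet.obj (TopCat.of A)).obj (Opposite.op (SimplexCategory.mk (n + 1)))) :
    inclSimp A n ((TopCat.toSSet.obj (TopCat.of A)).δ i x) =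
      act (inclSimp A (n + 1) x) (Tuple.face i) := by
  ext p
  rw [Simp.act_apply, combine_face]
  rfl

instance : Unique (Simp X 0) where
  default := Simp.mk ⟨fun p => absurd (stdSimplex.sum_eq_one p) (by simp), by
    have : IsEmpty (stdSimplex ℝ (Fin 0)) := ⟨fun p => absurd (stdSimplex.sum_eq_one p) (by simp)⟩
    exact continuous_of_const fun p => this.elim p⟩
  uniq x := by
    ext p
    exact absurd (stdSimplex.sum_eq_one p) (by simp)

/-- The augmented chains of the subspace `A`, as chains of singular simplices of `X`. -/
def inclChains (A : Set X) : ∀ n, (augmentedChains A).X n ⟶ AddCommGrpCat.of (Chains (Simp X) n)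
  | 0 => singleHom default
  | n + 1 => coprodToFinsupp _ ≫
      AddCommGrpCat.ofHom (Finsupp.lmapDomain ℤ ℤ (inclSimp A n)).toAddMonoidHom

/-- The inclusion of the summand of a singular simplex into the augmented chains. -/
def ιAugmented (A : Set X) {n : ℕ}
    (x : (TopCat.toSSet.obj (TopCat.of A)).obj (Opposite.op (SimplexCategory.mk n))) :
    coeff.{u} ⟶ (augmentedChains A).X (n + 1) :=
  (TopCat.toSSet.obj (TopCat.of A)).ιChainComplex (R := coeff.{u}) (n := n) x

theorem augmentedChains_hom_ext (A : Set X) {n : ℕ} {B : AddCommGrpCat.{u}}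
    {f g : (augmentedChains A).X (n + 1) ⟶ B} (h : ∀ x, ιAugmented A x ≫ f = ιAugmented A x ≫ g) :
    f = g :=
  SSet.chainComplex_hom_ext (X := TopCat.toSSet.obj (TopCat.of A)) h

theorem ιAugmented_d_zero (A : Set X)
    (x : (TopCat.toSSet.obj (TopCat.of A)).obj (Opposite.op (SimplexCategory.mk 0))) :
    ιAugmented A x ≫ (augmentedChains A).d 1 0 =
      (𝟙 coeff.{u} : coeff.{u} ⟶ (augmentedChains A).X 0) :=
  Sigma.ι_desc _ _

theorem ιAugmented_d_succ (A : Set X) {n : ℕ}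
    (x : (TopCat.toSSet.obj (TopCat.of A)).obj (Opposite.op (SimplexCategory.mk (n + 1)))) :
    ιAugmented A x ≫ (augmentedChains A).d (n + 2) (n + 1) =
      ∑ i : Fin (n + 2), (-1 : ℤ) ^ (i : ℕ) •
        ιAugmented A ((TopCat.toSSet.obj (TopCat.of A)).δ i x) :=
  SSet.ιChainComplex_d _ _ x

theorem ιAugmented_inclChains (A : Set X) {n : ℕ}
    (x : (TopCat.toSSet.obj (TopCat.of A)).obj (Opposite.op (SimplexCategory.mk n))) :
    ιAugmented A x ≫ inclChains A (n + 1) = singleHom (inclSimp A n x) := by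
  refine (Sigma.ι_desc_assoc _ _ _).trans ?_
  refine AddCommGrpCat.hom_ext (AddMonoidHom.ext fun z => ?_)
  exact Finsupp.mapDomain_single (f := inclSimp A n) (a := x) (b := z.down)

theorem inclChains_injective (A : Set X) (n : ℕ) : Function.Injective (inclChains A n) := by
  cases n with
  | zero =>
    intro x y h
    exact ULift.down_injective (Finsupp.single_injective (M := ℤ) (default : Simp X 0) h)
  | succ n =>
    have h := Finsupp.mapDomain_injective (M := ℤ) (inclSimp_injective A n)
    exact h.comp (coprodToFinsupp_bijective _).1

theorem mem_chainsIn_simpIn (A : Set X) (n : ℕ) (c : Chains (Simp X) n) :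
    c ∈ chainsIn (simpIn A) n ↔ ∃ z, inclChains A n z = c := by
  cases n with
  | zero =>
    have h : simpIn A 0 = Set.univ := Set.eq_univ_of_forall fun x p =>
      absurd (stdSimplex.sum_eq_one p) (by simp)
    rw [chainsIn, h, Finsupp.supported_univ]
    refine ⟨fun _ => ⟨ULift.up (c default), ?_⟩, fun _ => trivial⟩
    exact (Finsupp.unique_single c).symm
  | succ n =>
    rw [chainsIn, ← range_inclSimp, ← Set.image_univ, ← Finsupp.lmapDomain_supported,
      Finsupp.supported_univ, Submodule.map_top]
    constructor
    · rintro ⟨a, rfl⟩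
      obtain ⟨z, rfl⟩ := (coprodToFinsupp_bijective _).2 a
      exact ⟨z, rfl⟩
    · rintro ⟨z, rfl⟩
      exact ⟨_, rfl⟩

theorem inclChains_d (A : Set X) (n : ℕ) :
    (augmentedChains A).d (n + 1) n ≫ inclChains A n =
      inclChains A (n + 1) ≫ AddCommGrpCat.ofHom (bd (P := Simp X) (n := n)).toAddMonoidHom := by
  have hb : ∀ {n : ℕ} (x : Simp X (n + 1)),
      singleHom x ≫ AddCommGrpCat.ofHom (bd (P := Simp X) (n := n)).toAddMonoidHom =
        ∑ i : Fin (n + 1), (-1 : ℤ) ^ (i : ℕ) • singleHom (act x (Tuple.face i)) := by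
    intro n x
    refine coeff_hom_ext ?_
    change bd (Finsupp.single x 1) = _
    rw [bd_single]
    let ev : (coeff.{u} ⟶ AddCommGrpCat.of (Chains (Simp X) n)) →+ Chains (Simp X) n :=
      (AddMonoidHom.eval (ULift.up 1 : coeff.{u})).comp
        AddCommGrpCat.homAddEquiv.toAddMonoidHom
    change _ = ev _
    rw [map_sum]
    refine Finset.sum_congr rfl fun i _ => ?_
    rw [map_zsmul]
    change _ = (-1 : ℤ) ^ (i : ℕ) • Finsupp.single (act x (Tuple.face i)) (1 : ℤ)
    rw [Finsupp.smul_single, smul_eq_mul, mul_comm]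
  refine augmentedChains_hom_ext A fun x => ?_
  rw [← Category.assoc, ← Category.assoc, ιAugmented_inclChains, hb]
  cases n with
  | zero =>
    rw [ιAugmented_d_zero, Fin.sum_univ_one,
      Subsingleton.elim (act (inclSimp A 0 x) _) (default : Simp X 0)]
    simp only [Fin.val_zero, pow_zero, one_smul]
    exact Category.id_comp _
  | succ n =>
    rw [ιAugmented_d_succ, Preadditive.sum_comp]
    refine Finset.sum_congr rfl fun i _ => ?_
    rw [Preadditive.zsmul_comp, ιAugmented_inclChains, inclSimp_δ]

theorem nonempty_H_iso (A : Set X) (q : ℤ) : Nonempty (H A q ≅ HIn (simpIn A) q) := by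
  have h := nonempty_homology_iso (augmentedChains A) (inclChains A) (inclChains_injective A)
    (mem_chainsIn_simpIn A) (fun n z => ConcreteCategory.congr_hom (inclChains_d A n) z)
  match q with
  | Int.ofNat n => exact h (n + 1)
  | Int.negSucc 0 => exact h 0
  | Int.negSucc (_ + 1) => exact ⟨Iso.refl _⟩

/-! ### Unions and intersections of subspaces -/

theorem isStable_simpIn (A : Set X) : IsStable (simpIn A) :=
  fun _ _ _ _ hx p => hx (combine p _)

theorem IsAcyclic.acyclicIn {A : Set X} (h : IsAcyclic A) : AcyclicIn (simpIn A) := by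
  rw [← isZero_HIn_iff]
  intro q
  obtain ⟨e⟩ := nonempty_H_iso A q
  exact (h q).of_iso e.symm

theorem simpIn_interOf {S : Type*} (U : S → Set X) (θ : Finset S) :
    simpIn (interOf U θ) = ⨅ i ∈ θ, simpIn (U i) := by
  funext n
  ext x
  simp only [interOf, simpIn, iInf_apply, Set.iInf_eq_iInter, Set.mem_iInter, Set.mem_ofPred_eq]
  exact ⟨fun h i hi p => h p i hi, fun h p i hi => h i hi p⟩

/-- The small simplices theorem. -/
theorem nonempty_HIn_iSup_simpIn_iso {S : Type*} (U : S → Set X) (θ : Finset S)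
    (hθ : θ.Nonempty) (hex : IsExcisive (fun i : θ => U i)) (q : ℤ) :
    Nonempty (HIn (⨆ i ∈ θ, simpIn (U i)) q ≅ HIn (simpIn (unionOf U θ)) q) := by
  have hU : unionOf U θ = ⋃ i : θ, U i := by
    rw [unionOf, Set.iUnion_subtype]
  have hS : ⨆ i ∈ θ, simpIn (U i) = ⨆ i : θ, simpIn (U i) := by
    rw [iSup_subtype]
  have hne : Nonempty θ := hθ.to_subtype
  rw [hU, hS]
  refine nonempty_HIn_iso_of_Sd (IsStable.iSup fun i => isStable_simpIn _) (isStable_simpIn _)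
    ?_ ?_ q
  · exact iSup_le fun i n x hx p => Set.mem_iUnion.2 ⟨i, hx p⟩
  · intro n x hx
    obtain ⟨k, hk⟩ := hex.exists_Sd_iterate_mem hx
    refine ⟨k, ?_⟩
    rwa [chainsIn, iSup_apply]

end ReducedSingular

end

theorem proposition1 {X : Type u} [TopologicalSpace X] {S : Type*} [Finite S] (U : S → Set X)
    (k : ℕ) (hk : 1 ≤ k) (hA : ReducedSingular.ConditionA U (k - 1))
    (θ : Finset S) (hθ : θ.card = k + 1)
    (hex : ReducedSingular.IsExcisive (fun α : θ => U α)) (q : ℤ) :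
    Nonempty (ReducedSingular.H (ReducedSingular.unionOf U θ) q ≅
      ReducedSingular.H (ReducedSingular.interOf U θ) (q - k)) := by
  open ReducedSingular in
  obtain ⟨e₁⟩ := nonempty_H_iso (unionOf U θ) q
  obtain ⟨e₂⟩ := nonempty_HIn_iSup_simpIn_iso U θ (Finset.card_pos.1 (by omega)) hex q
  obtain ⟨e₃⟩ := nonempty_HIn_iSup_iso k (fun i => simpIn (U i)) θ (fun i => isStable_simpIn _) hθ
    (fun σ _ hn hc => by
      rw [← simpIn_interOf]
      exact (hA σ hn (by omega)).acyclicIn) q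
  obtain ⟨e₄⟩ := nonempty_H_iso (interOf U θ) (q - k)
  rw [simpIn_interOf] at e₄
  exact ⟨e₁ ≪≫ e₂.symm ≪≫ e₃ ≪≫ e₄.symm⟩
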